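/- **Theorem 3.** Let $\varphi\in L_2(\mathbb R^n)$ (complex-valued) be such that its integer shifts $\varphi(\cdot-h)$, $h\in\mathbb Z^n$, form an orthonormal system, and let $W^n\subset L_2(\mathbb R^n)$ be the closed linear span of these shifts. Let $$\hat\varphi(\omega)=\int_{\mathbb R^n}\varphi(x)e^{-i\langle x,\omega\rangle}\,dx$$ be the Fourier transform (in the sense of Plancherel), so that $\sum_{\ell\in\mathbb Z^n}|\hat\varphi(\omega+2\pi\ell)|^2=1$ for almost every $\omega$. Let $k=(k_1,\dots,k_n)\in\mathbb Z^n$ and suppose that $$M_k:=\operatorname*{ess\,sup}_{\omega\in\mathbb R^n}\ \sum_{\ell\in\mathbb Z^n}\ \prod_{s=1}^n|\omega_s+2\pi\ell_s|^{2k_s}\,|\hat\varphi(\omega+2\pi\ell)|^2<\infty .$$ Then every $f\in W^n$ has a unique mixed derivative $\partial^kf=\dfrac{\partial^{k}f}{\partial x_1^{k_1}\cdots\partial x_n^{k_n}}\in L_2(\mathbb R^n)$, and $$\|\partial^kf\|_2^2\le M_k\,\|f\|_2^2 .$$ The constant $M_k$ cannot be improved: there are nonzero $f_m\in W^n$, $m=0,1,2,\dots$,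 with $$\frac{\|\partial^kf_m\|_2^2}{\|f_m\|_2^2}\longrightarrow M_k\qquad(m\to\infty).$$ Here, for $k_s\ge0$, $\partial^kf$ is the weak (distributional) derivative; if some $k_s$ are negative, $\partial^kf$ denotes the function $g\in L_2(\mathbb R^n)$ with $\partial^{k^-}g=\partial^{k^+}f$ in the sense of tempered distributions, where $k_s^+=\max(k_s,0)$ and $k_s^-=\max(-k_s,0)$. -/

import Mathlib

open MeasureTheory Filter Topology
open scoped ENNReal FourierTransform SchwartzMap LineDeriv

noncomputable section

namespace ShiftInvariant

/-- The complex Hilbert space `L₂(ℝⁿ)`. -/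
abbrev L2 (n : ℕ) : Type :=
  Lp ℂ 2 (volume : Measure (EuclideanSpace ℝ (Fin n)))

/-- The point of `ℝⁿ` with integer coordinates `h`. -/
def intPoint {n : ℕ} (h : Fin n → ℤ) : EuclideanSpace ℝ (Fin n) :=
  WithLp.toLp 2 fun s => (h s : ℝ)

/-- The integer shift `φ(· - h)`. -/
def shift {n : ℕ} (h : Fin n → ℤ) (φ : L2 n) : L2 n :=
  Lp.compMeasurePreserving (fun x => x - intPoint h)
    (measurePreserving_sub_right volume (intPoint h)) φ

/-- `Wⁿ`: the closed subspace of `L₂(ℝⁿ)` generated by the integer shifts of `φ`. -/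
def W {n : ℕ} (φ : L2 n) : Submodule ℂ (L2 n) :=
  (Submodule.span ℂ (Set.range fun h : Fin n → ℤ => shift h φ)).topologicalClosure

/-- The Fourier transform `φ̂(ω) = ∫ φ(x) e^{-i⟨x, ω⟩} dx` of `φ ∈ L₂(ℝⁿ)` (extended from
integrable functions by Plancherel), for which `‖φ‖² = (2π)⁻ⁿ ‖φ̂‖²`.  Mathlib's `𝓕` has the kernel
`e^{-2πi⟨x, ξ⟩}`, whence the dilation. -/
def hat {n : ℕ} (φ : L2 n) (ω : EuclideanSpace ℝ (Fin n)) : ℂ :=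
  (𝓕 φ : L2 n) ((2 * Real.pi)⁻¹ • ω)

/-- The periodization `∑_{ℓ ∈ ℤⁿ} ∏ₛ |ωₛ + 2πℓₛ|^{2kₛ} |φ̂(ω + 2πℓ)|²`, with values
in `[0, ∞]`. -/
def symbol {n : ℕ} (k : Fin n → ℤ) (φ : L2 n) (ω : EuclideanSpace ℝ (Fin n)) : ℝ≥0∞ :=
  ∑' ℓ : Fin n → ℤ, ENNReal.ofReal
    ((∏ s, |ω s + 2 * Real.pi * (ℓ s : ℝ)| ^ (2 * k s)) *
      ‖hat φ (ω + (2 * Real.pi) • intPoint ℓ)‖ ^ 2)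

/-- The supremum over `ω` of the periodization.  As `φ̂` is defined up to a null set, this is the
essential supremum. -/
def supSymbol {n : ℕ} (k : Fin n → ℤ) (φ : L2 n) : ℝ≥0∞ :=
  essSup (symbol k φ) volume

/-- The mixed partial derivative `∂^{j₁+…+jₙ} / ∂x₁^{j₁} ⋯ ∂xₙ^{jₙ}` of tempered distributions. -/
def mixedPartial {n : ℕ} (j : Fin n → ℕ) (T : 𝓢'(EuclideanSpace ℝ (Fin n), ℂ)) :
    𝓢'(EuclideanSpace ℝ (Fin n), ℂ) :=
  (List.finRange n).foldr
    (fun s U => (fun V : 𝓢'(EuclideanSpace ℝ (Fin n), ℂ) =>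
      ∂_{EuclideanSpace.single s (1 : ℝ)} V)^[j s] U) T

/-- `g ∈ L₂(ℝⁿ)` is the (weak) derivative `∂^k f` of `f ∈ L₂(ℝⁿ)`.  For `k ≥ 0` this says that the
distributional derivative `∂^k f` is the function `g`; negative entries of `k` mean
antidifferentiation: with `k = k⁺ - k⁻` it says `∂^{k⁺} f = ∂^{k⁻} g`. -/
def IsMixedDeriv {n : ℕ} (k : Fin n → ℤ) (f g : L2 n) : Prop :=
  mixedPartial (fun s => (k s).toNat) (f : 𝓢'(EuclideanSpace ℝ (Fin n), ℂ)) =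
    mixedPartial (fun s => (-k s).toNat) (g : 𝓢'(EuclideanSpace ℝ (Fin n), ℂ))

end ShiftInvariant

end

/-!
The Fourier transform turns every object of the theorem into a multiplication operator. A shift by
`h` becomes the multiplication by the character `e^{-2πi⟨h, ξ⟩}` (`fourier_shift`), and `∂^k`
becomes the multiplication by `∏ (2πiξₛ)^{kₛ}` (`isMixedDeriv_iff_fourier`); for negative `kₛ` this
uses that the coordinate hyperplanes are null sets. In particular `∂^k f` is unique.

For a finite combination `f = ∑ c_h φ(· - h)`, with the trigonometric polynomial
`p = ∑ c_h e^{-2πi⟨h, ·⟩}`, this gives two identities. As both the shifts of `φ` and the characters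
are orthonormal, `‖f‖` is the `L₂` norm of `p` over the unit cube (`enorm_shiftSum`). As `p` is
`ℤⁿ`-periodic, folding the integral of `|p|² |multiplier|² |φ̂|²` over `ℝⁿ` into the cube shows that
`‖∂^k f‖` is the `L₂` norm of `p` over the cube with the periodized symbol as weight
(`eLpNorm_multiplier_mul_fourier_shiftSum`). The weight is at most `M_k` almost everywhere, whence
the inequality for finite combinations; Fatou's lemma extends it, together with the existence of the
derivative, to their closure `W φ` (`eLpNorm_multiplier_mul_fourier_le`).

If some constant `b < M_k` served for all finite combinations, the weighted `L₂` norm of every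
trigonometric polynomial would be at most `√b` times the unweighted one. Trigonometric polynomials
being dense in `L₂` of the torus, the same would hold for indicators of measurable sets, so that
the weight would be at most `b` almost everywhere (`ae_le_of_eLpNorm_trigPoly_le`), contradicting
the definition of `M_k`.
-/

namespace ShiftInvariant

/-! ### The Fourier transform of a shift -/

/-- The projection `ℝⁿ → ℝⁿ / ℤⁿ`. -/
def torusProj {n : ℕ} (ξ : EuclideanSpace ℝ (Fin n)) : UnitAddTorus (Fin n) :=
  fun s => (ξ s : UnitAddCircle)

lemma continuous_torusProj {n : ℕ} : Continuous (torusProj (n := n)) := by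
  unfold torusProj
  refine continuous_pi fun s => ?_
  exact (AddCircle.continuous_mk' 1).comp (by fun_prop)

@[simp] lemma torusProj_add_intPoint {n : ℕ} (ξ : EuclideanSpace ℝ (Fin n)) (h : Fin n → ℤ) :
    torusProj (ξ + intPoint h) = torusProj ξ := by
  funext s
  simp [torusProj, intPoint]

lemma mFourier_torusProj {n : ℕ} (h : Fin n → ℤ) (ξ : EuclideanSpace ℝ (Fin n)) :
    UnitAddTorus.mFourier (-h) (torusProj ξ) =
      (Real.fourierChar (-(inner ℝ (intPoint h) ξ)) : ℂ) := by
  simp only [UnitAddTorus.mFourier, ContinuousMap.coe_mk, torusProj, fourier_coe_apply,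
    Real.fourierChar_apply, ← Complex.exp_sum]
  congr 1
  simp only [intPoint, PiLp.inner_apply, RCLike.inner_apply, conj_trivial]
  push_cast
  rw [← Finset.sum_neg_distrib, Finset.mul_sum, Finset.sum_mul]
  refine Finset.sum_congr rfl fun s _ => ?_
  simp
  ring

lemma norm_mFourier_apply {n : ℕ} (h : Fin n → ℤ) (t : UnitAddTorus (Fin n)) :
    ‖UnitAddTorus.mFourier h t‖ = 1 := by
  rw [UnitAddTorus.mFourier, ContinuousMap.coe_mk, norm_prod]
  exact Finset.prod_eq_one fun s _ => Circle.norm_coe _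

lemma fourier_shift_schwartz {n : ℕ} (h : Fin n → ℤ) (u : 𝓢(EuclideanSpace ℝ (Fin n), ℂ))
    (ξ : EuclideanSpace ℝ (Fin n)) :
    𝓕 (u.compSubConstCLM ℂ (intPoint h)) ξ =
      UnitAddTorus.mFourier (-h) (torusProj ξ) * 𝓕 u ξ := by
  rw [mFourier_torusProj]
  have := congrFun (VectorFourier.fourierIntegral_comp_add_right Real.fourierChar
    (volume : Measure (EuclideanSpace ℝ (Fin n))) (innerₗ _) u (-intPoint h)) ξ
  simp only [map_neg, LinearMap.neg_apply, innerₗ_apply_apply, Circle.smul_def, smul_eq_mul] at this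
  exact this

lemma memLp_top_mFourier {n : ℕ} (h : Fin n → ℤ) :
    MemLp (fun ξ : EuclideanSpace ℝ (Fin n) => UnitAddTorus.mFourier h (torusProj ξ)) ∞ volume :=
  memLp_top_of_bound (by
    exact ((UnitAddTorus.mFourier h).continuous.comp continuous_torusProj).aestronglyMeasurable) 1
    (Eventually.of_forall fun ξ => (norm_mFourier_apply h _).le)

/-- In frequency, the shift by `h` is the multiplication by the character `e^{-2πi⟨h, ξ⟩}`. -/
lemma fourier_shift {n : ℕ} (h : Fin n → ℤ) (f : L2 n) :
    (𝓕 (shift h f) : L2 n) =ᵐ[volume]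
      fun ξ => UnitAddTorus.mFourier (-h) (torusProj ξ) * (𝓕 f : L2 n) ξ := by
  set e := (memLp_top_mFourier (-h)).toLp with he
  -- Both sides are continuous in `f`, and for Schwartz functions the identity is pointwise.
  have key : (𝓕 (shift h f) : L2 n) =
      (ContinuousLinearMap.mul ℂ ℂ).holder 2 e (𝓕 f : L2 n) := by
    refine DenseRange.induction_on (SchwartzMap.denseRange_toLpCLM (p := 2) (F := ℂ)
      (μ := (volume : Measure (EuclideanSpace ℝ (Fin n)))) ENNReal.ofNat_ne_top) f ?_ ?_
    · apply isClosed_eq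
      · exact (FourierTransform.fourierCLM ℂ (L2 n)).continuous.comp
          (Lp.isometry_compMeasurePreserving _).continuous
      · exact ((ContinuousLinearMap.mul ℂ ℂ).holderL volume ∞ 2 2 e).continuous.comp
          (FourierTransform.fourierCLM ℂ (L2 n)).continuous
    · intro u
      have h1 : shift h (u.toLp 2) = (u.compSubConstCLM ℂ (intPoint h)).toLp 2 := by
        ext1
        have hm := measurePreserving_sub_right
          (volume : Measure (EuclideanSpace ℝ (Fin n))) (intPoint h)
        filter_upwards [Lp.coeFn_compMeasurePreserving (u.toLp 2) hm,
          hm.quasiMeasurePreserving.ae_eq (u.coeFn_toLp 2 volume),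
          (u.compSubConstCLM ℂ (intPoint h)).coeFn_toLp 2 volume] with x h1 h2 h3
        exact h1.trans (h2.trans h3.symm)
      change (𝓕 (shift h (u.toLp 2)) : L2 n) =
        (ContinuousLinearMap.mul ℂ ℂ).holder 2 e (𝓕 (u.toLp 2) : L2 n)
      rw [h1, SchwartzMap.toLp_fourier_eq, SchwartzMap.toLp_fourier_eq]
      ext1
      filter_upwards [(𝓕 (u.compSubConstCLM ℂ (intPoint h))).coeFn_toLp 2 volume,
        (𝓕 u).coeFn_toLp 2 volume, (memLp_top_mFourier (-h)).coeFn_toLp,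
        (ContinuousLinearMap.mul ℂ ℂ).coeFn_holder (r := 2) e ((𝓕 u).toLp 2)] with x h1 h2 h3 h4
      rw [h1, h4, h2, he, h3, fourier_shift_schwartz, ContinuousLinearMap.mul_apply']
  rw [key]
  filter_upwards [(memLp_top_mFourier (-h)).coeFn_toLp,
    (ContinuousLinearMap.mul ℂ ℂ).coeFn_holder (r := 2) e (𝓕 f : L2 n)] with x h3 h4
  rw [h4, he, h3, ContinuousLinearMap.mul_apply']

/-! ### Mixed derivatives in frequency -/

/-- The Fourier multiplier `∏ₛ (2πiξₛ)^{kₛ}` of the mixed derivative `∂^k`. Where `ξₛ = 0` and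
`kₛ < 0` it takes the value `0`; these points form a null set. -/
noncomputable def multiplier {n : ℕ} (k : Fin n → ℤ) (ξ : EuclideanSpace ℝ (Fin n)) : ℂ :=
  ∏ s, (2 * Real.pi * Complex.I * (ξ s : ℂ)) ^ k s

lemma measurable_multiplier {n : ℕ} (k : Fin n → ℤ) : Measurable (multiplier k) := by
  unfold multiplier
  refine Finset.measurable_prod _ fun s _ => ?_
  exact Measurable.pow_const (by fun_prop) (k s)

lemma hasTemperateGrowth_coord_pow {n : ℕ} (s : Fin n) (m : ℕ) :
    (fun ξ : EuclideanSpace ℝ (Fin n) =>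
      (2 * Real.pi * Complex.I * (ξ s : ℂ)) ^ m).HasTemperateGrowth := by
  refine Function.HasTemperateGrowth.pow ?_ m
  refine (Function.HasTemperateGrowth.const _).mul ?_
  exact (Complex.ofRealCLM.comp (EuclideanSpace.proj s)).hasTemperateGrowth

lemma hasTemperateGrowth_list_prod {n : ℕ} (j : Fin n → ℕ) (L : List (Fin n)) :
    (fun ξ : EuclideanSpace ℝ (Fin n) =>
      (L.map fun s => (2 * Real.pi * Complex.I * (ξ s : ℂ)) ^ j s).prod).HasTemperateGrowth := by
  induction L with
  | nil => simp
  | cons s L ih =>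
    simp only [List.map_cons, List.prod_cons]
    exact (hasTemperateGrowth_coord_pow s (j s)).mul ih

lemma fourier_lineDeriv_coord {n : ℕ} (s : Fin n) (T : 𝓢'(EuclideanSpace ℝ (Fin n), ℂ)) :
    𝓕 (∂_{EuclideanSpace.single s (1 : ℝ)} T) =
      TemperedDistribution.smulLeftCLM ℂ
        (fun ξ : EuclideanSpace ℝ (Fin n) => 2 * Real.pi * Complex.I * (ξ s : ℂ)) (𝓕 T) := by
  have hg : (fun ξ : EuclideanSpace ℝ (Fin n) => (ξ s : ℂ)).HasTemperateGrowth :=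
    (Complex.ofRealCLM.comp (EuclideanSpace.proj s)).hasTemperateGrowth
  have h2 := TemperedDistribution.smulLeftCLM_smul (F := ℂ) hg (2 * Real.pi * Complex.I)
  rw [TemperedDistribution.fourier_lineDerivOp_eq]
  have h3 : (fun ξ : EuclideanSpace ℝ (Fin n) => 2 * Real.pi * Complex.I * (ξ s : ℂ)) =
      (2 * Real.pi * Complex.I) • fun ξ : EuclideanSpace ℝ (Fin n) => (ξ s : ℂ) := rfl
  rw [h3, h2]
  simp [EuclideanSpace.inner_single_right]

lemma fourier_lineDeriv_coord_iterate {n : ℕ} (s : Fin n) (m : ℕ)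
    (T : 𝓢'(EuclideanSpace ℝ (Fin n), ℂ)) :
    𝓕 ((fun V : 𝓢'(EuclideanSpace ℝ (Fin n), ℂ) =>
      ∂_{EuclideanSpace.single s (1 : ℝ)} V)^[m] T) =
      TemperedDistribution.smulLeftCLM ℂ
        (fun ξ : EuclideanSpace ℝ (Fin n) => (2 * Real.pi * Complex.I * (ξ s : ℂ)) ^ m) (𝓕 T) := by
  induction m with
  | zero => simp
  | succ m ih =>
    rw [Function.iterate_succ_apply', fourier_lineDeriv_coord, ih,
      TemperedDistribution.smulLeftCLM_smulLeftCLM_apply (hasTemperateGrowth_coord_pow s m)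
        (by simpa using hasTemperateGrowth_coord_pow s 1)]
    congr 1

lemma fourier_mixedPartial {n : ℕ} (j : Fin n → ℕ) (T : 𝓢'(EuclideanSpace ℝ (Fin n), ℂ)) :
    𝓕 (mixedPartial j T) =
      TemperedDistribution.smulLeftCLM ℂ
        (fun ξ : EuclideanSpace ℝ (Fin n) =>
          ∏ s, (2 * Real.pi * Complex.I * (ξ s : ℂ)) ^ j s) (𝓕 T) := by
  simp only [Fin.prod_univ_def, mixedPartial]
  induction List.finRange n with
  | nil => simp
  | cons s L ih =>
    rw [List.foldr_cons, fourier_lineDeriv_coord_iterate, ih,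
      TemperedDistribution.smulLeftCLM_smulLeftCLM_apply (hasTemperateGrowth_list_prod j L)
        (hasTemperateGrowth_coord_pow s (j s))]
    congr 2
    funext ξ
    simp [mul_comm]

/-- Functions of the form (temperate growth) times `L₂` are locally integrable, so they are
determined almost everywhere by the tempered distributions they define. -/
lemma smulLeftCLM_coe_eq_iff {n : ℕ} {a b : EuclideanSpace ℝ (Fin n) → ℂ}
    (ha : a.HasTemperateGrowth) (hb : b.HasTemperateGrowth) (F G : L2 n) :
    TemperedDistribution.smulLeftCLM ℂ a (F : 𝓢'(EuclideanSpace ℝ (Fin n), ℂ)) =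
      TemperedDistribution.smulLeftCLM ℂ b (G : 𝓢'(EuclideanSpace ℝ (Fin n), ℂ)) ↔
    (fun ξ => a ξ * F ξ) =ᵐ[volume] fun ξ => b ξ * G ξ := by
  constructor
  · intro h
    have loc : ∀ {c : EuclideanSpace ℝ (Fin n) → ℂ} (_ : c.HasTemperateGrowth) (H : L2 n),
        LocallyIntegrable (fun ξ => c ξ * H ξ) volume := by
      intro c hc H
      rw [← locallyIntegrableOn_univ]
      exact (((Lp.memLp H).locallyIntegrable (by norm_num)).locallyIntegrableOn
        Set.univ).continuousOn_mul hc.1.continuous.continuousOn isOpen_univ.isLocallyClosed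
    refine ae_eq_of_integral_contDiff_smul_eq (loc ha F) (loc hb G) fun u hu hc => ?_
    have h1 : HasCompactSupport (Complex.ofRealCLM ∘ u) := hc.comp_left rfl
    have h2 : ContDiff ℝ ((⊤ : ℕ∞) : WithTop ℕ∞) (Complex.ofRealCLM ∘ u) := by fun_prop
    have := congrArg (fun T : 𝓢'(EuclideanSpace ℝ (Fin n), ℂ) => T (h1.toSchwartzMap h2)) h
    simp only [TemperedDistribution.smulLeftCLM_apply_apply, Lp.toTemperedDistribution_apply,
      SchwartzMap.smulLeftCLM_apply_apply ha, SchwartzMap.smulLeftCLM_apply_apply hb] at this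
    simpa [mul_left_comm, mul_assoc] using this
  · intro h
    ext u
    simp only [TemperedDistribution.smulLeftCLM_apply_apply, Lp.toTemperedDistribution_apply,
      SchwartzMap.smulLeftCLM_apply_apply ha, SchwartzMap.smulLeftCLM_apply_apply hb]
    refine integral_congr_ae ?_
    filter_upwards [h] with ξ hξ
    simp only [smul_eq_mul]
    linear_combination u ξ * hξ

/-- The coordinate hyperplanes are null sets. -/
lemma ae_coord_ne_zero {n : ℕ} :
    ∀ᵐ ξ : EuclideanSpace ℝ (Fin n), ∀ s, ξ s ≠ 0 := by
  rw [ae_all_iff]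
  intro s
  have h := Measure.addHaar_submodule (volume : Measure (EuclideanSpace ℝ (Fin n)))
    (LinearMap.ker (EuclideanSpace.proj (𝕜 := ℝ) s : EuclideanSpace ℝ (Fin n) →L[ℝ] ℝ).toLinearMap)
    (by
      intro htop
      have : EuclideanSpace.single s (1 : ℝ) ∈ LinearMap.ker
          (EuclideanSpace.proj (𝕜 := ℝ) s : EuclideanSpace ℝ (Fin n) →L[ℝ] ℝ).toLinearMap := by
        rw [htop]; trivial
      simp at this)
  rw [ae_iff]
  convert h using 2
  ext ξ
  simp

/-- In frequency, `g = ∂^k f` means that `ĝ` is `f̂` times the multiplier, also for exponents of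
mixed signs: the multiplier of `∂^{k⁻}` vanishes only on a null set, so it may be divided by. -/
lemma isMixedDeriv_iff_fourier {n : ℕ} {k : Fin n → ℤ} {f g : L2 n} :
    IsMixedDeriv k f g ↔
      (𝓕 g : L2 n) =ᵐ[volume] fun ξ => multiplier k ξ * (𝓕 f : L2 n) ξ := by
  have hinj : Function.Injective
      (𝓕 : 𝓢'(EuclideanSpace ℝ (Fin n), ℂ) → 𝓢'(EuclideanSpace ℝ (Fin n), ℂ)) :=
    Function.LeftInverse.injective (g := 𝓕⁻) FourierTransform.fourierInv_fourier_eq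
  have hgrowth : ∀ j : Fin n → ℕ, (fun ξ : EuclideanSpace ℝ (Fin n) =>
      ∏ s, (2 * Real.pi * Complex.I * (ξ s : ℂ)) ^ j s).HasTemperateGrowth := by
    intro j
    simpa only [Fin.prod_univ_def] using hasTemperateGrowth_list_prod j (List.finRange n)
  rw [IsMixedDeriv, ← hinj.eq_iff, fourier_mixedPartial, fourier_mixedPartial,
    Lp.fourier_toTemperedDistribution_eq, Lp.fourier_toTemperedDistribution_eq,
    smulLeftCLM_coe_eq_iff (hgrowth _) (hgrowth _)]
  have key : ∀ᵐ ξ : EuclideanSpace ℝ (Fin n),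
      (∏ s, (2 * Real.pi * Complex.I * (ξ s : ℂ)) ^ (-k s).toNat ≠ 0) ∧
      ∏ s, (2 * Real.pi * Complex.I * (ξ s : ℂ)) ^ (k s).toNat =
        (∏ s, (2 * Real.pi * Complex.I * (ξ s : ℂ)) ^ (-k s).toNat) * multiplier k ξ := by
    filter_upwards [ae_coord_ne_zero] with ξ hξ
    have hne : ∀ s, (2 * Real.pi * Complex.I * (ξ s : ℂ)) ≠ 0 := fun s => by
      simp [Real.pi_ne_zero, hξ s]
    refine ⟨Finset.prod_ne_zero_iff.2 fun s _ => pow_ne_zero _ (hne s), ?_⟩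
    rw [multiplier, ← Finset.prod_mul_distrib]
    refine Finset.prod_congr rfl fun s _ => ?_
    rw [← zpow_natCast, ← zpow_natCast, ← zpow_add₀ (hne s)]
    congr 1
    omega
  constructor
  · intro h
    filter_upwards [h, key] with ξ h1 h2
    refine mul_left_cancel₀ h2.1 ?_
    rw [← h1, h2.2, mul_assoc]
  · intro h
    filter_upwards [h, key] with ξ h1 h2
    rw [h1, h2.2, mul_assoc]

lemma exists_isMixedDeriv {n : ℕ} {k : Fin n → ℤ} {f : L2 n}
    (h : MemLp (fun ξ => multiplier k ξ * (𝓕 f : L2 n) ξ) 2 volume) :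
    ∃ g, IsMixedDeriv k f g := by
  refine ⟨𝓕⁻ h.toLp, isMixedDeriv_iff_fourier.2 ?_⟩
  rw [FourierTransform.fourier_fourierInv_eq]
  exact h.coeFn_toLp

lemma IsMixedDeriv.unique {n : ℕ} {k : Fin n → ℤ} {f g g' : L2 n}
    (h : IsMixedDeriv k f g) (h' : IsMixedDeriv k f g') : g = g' := by
  have : (𝓕 g : L2 n) = 𝓕 g' :=
    Lp.ext ((isMixedDeriv_iff_fourier.1 h).trans (isMixedDeriv_iff_fourier.1 h').symm)
  exact (Lp.fourierTransformₗᵢ (EuclideanSpace ℝ (Fin n)) ℂ).injective this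

lemma IsMixedDeriv.enorm_eq {n : ℕ} {k : Fin n → ℤ} {f g : L2 n} (h : IsMixedDeriv k f g) :
    ‖g‖ₑ = eLpNorm (fun ξ => multiplier k ξ * (𝓕 f : L2 n) ξ) 2 volume := by
  rw [← eLpNorm_congr_ae (isMixedDeriv_iff_fourier.1 h), ← Lp.enorm_def, ← ofReal_norm,
    ← ofReal_norm, Lp.norm_fourier_eq]

/-! ### Trigonometric polynomials on the unit cube -/

/-- The half-open unit cube `(0, 1]ⁿ`, a fundamental domain for `ℤⁿ`. -/
def unitCube (n : ℕ) : Set (EuclideanSpace ℝ (Fin n)) :=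
  {ξ | ∀ s, ξ s ∈ Set.Ioc (0 : ℝ) 1}

lemma measurableSet_unitCube (n : ℕ) : MeasurableSet (unitCube n) := by
  have : unitCube n = ⋂ s, (fun ξ : EuclideanSpace ℝ (Fin n) => ξ s) ⁻¹' Set.Ioc (0 : ℝ) 1 := by
    ext; simp [unitCube]
  rw [this]
  exact MeasurableSet.iInter fun s => measurableSet_Ioc.preimage (by fun_prop)

/-- The Haar probability measure of the torus. -/
noncomputable abbrev haarTorus (n : ℕ) : Measure (UnitAddTorus (Fin n)) :=
  Measure.pi fun _ => AddCircle.haarAddCircle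

lemma measurePreserving_torusProj (n : ℕ) :
    MeasurePreserving (torusProj (n := n)) (volume.restrict (unitCube n)) (haarTorus n) := by
  have h1 : MeasurePreserving (fun x : ℝ => (x : UnitAddCircle))
      (volume.restrict (Set.Ioc (0 : ℝ) 1)) AddCircle.haarAddCircle := by
    have := UnitAddCircle.measurePreserving_mk 0
    rw [zero_add] at this
    convert this using 1
    rw [AddCircle.volume_eq_smul_haarAddCircle]
    simp
  have h2 := measurePreserving_pi (fun _ : Fin n => volume.restrict (Set.Ioc (0 : ℝ) 1))
    (fun _ => AddCircle.haarAddCircle) fun _ => h1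
  rw [← Measure.restrict_pi_pi] at h2
  have h3 := (PiLp.volume_preserving_ofLp (Fin n)).restrict_preimage
    (MeasurableSet.univ_pi fun _ : Fin n => measurableSet_Ioc (a := (0 : ℝ)) (b := 1))
  have h4 : WithLp.ofLp ⁻¹' (Set.univ.pi fun _ : Fin n => Set.Ioc (0 : ℝ) 1) = unitCube n := by
    ext; simp [unitCube]
  rw [h4] at h3
  exact h2.comp h3

instance isFiniteMeasure_unitCube (n : ℕ) :
    IsFiniteMeasure ((volume : Measure (EuclideanSpace ℝ (Fin n))).restrict (unitCube n)) := by
  constructor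
  have h := (measurePreserving_torusProj n).measure_preimage MeasurableSet.univ.nullMeasurableSet
  rw [Set.preimage_univ] at h
  rw [h]
  exact measure_lt_top _ _

/-- The representative in the unit cube of a point of the torus. -/
noncomputable def torusLift {n : ℕ} (t : UnitAddTorus (Fin n)) : EuclideanSpace ℝ (Fin n) :=
  WithLp.toLp 2 fun s => (AddCircle.measurableEquivIoc 1 0 (t s) : ℝ)

lemma measurable_torusLift {n : ℕ} : Measurable (torusLift (n := n)) := by
  refine (WithLp.measurable_toLp 2 _).comp (measurable_pi_lambda _ fun s => ?_)
  exact measurable_subtype_coe.comp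
    ((AddCircle.measurableEquivIoc 1 0).measurable.comp (measurable_pi_apply s))

lemma torusLift_torusProj {n : ℕ} {ξ : EuclideanSpace ℝ (Fin n)} (hξ : ξ ∈ unitCube n) :
    torusLift (torusProj ξ) = ξ := by
  ext s
  have hs : ξ s ∈ Set.Ioc (0 : ℝ) (0 + 1) := by simpa using hξ s
  exact congrArg Subtype.val ((AddCircle.measurableEquivIoc (1 : ℝ) 0).apply_symm_apply ⟨ξ s, hs⟩)

/-- The trigonometric polynomial `∑ c_h e^{-2πi⟨h, ·⟩}`, as a function on the torus. The sign of
the exponent is the one produced by the shift by `h`. -/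
noncomputable def trigPoly {n : ℕ} (c : (Fin n → ℤ) →₀ ℂ) : C(UnitAddTorus (Fin n), ℂ) :=
  Finsupp.linearCombination ℂ (fun h => UnitAddTorus.mFourier (-h)) c

lemma norm_linearCombination_eq_of_orthonormal {ι H K : Type*}
    [NormedAddCommGroup H] [InnerProductSpace ℂ H] [NormedAddCommGroup K] [InnerProductSpace ℂ K]
    {v : ι → H} {w : ι → K} (hv : Orthonormal ℂ v) (hw : Orthonormal ℂ w) (c : ι →₀ ℂ) :
    ‖Finsupp.linearCombination ℂ v c‖ = ‖Finsupp.linearCombination ℂ w c‖ := by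
  rw [@norm_eq_sqrt_re_inner ℂ, @norm_eq_sqrt_re_inner ℂ, hv.inner_finsupp_eq_sum_left,
    hw.inner_finsupp_eq_sum_left]

lemma orthonormal_mFourierLp_neg (n : ℕ) :
    Orthonormal ℂ fun h : Fin n → ℤ =>
      ContinuousMap.toLp (E := ℂ) 2 (haarTorus n) ℂ (UnitAddTorus.mFourier (-h)) :=
  (UnitAddTorus.orthonormal_mFourier (d := Fin n)).comp _ neg_injective

lemma toLp_trigPoly {n : ℕ} (c : (Fin n → ℤ) →₀ ℂ) :
    ContinuousMap.toLp (E := ℂ) 2 (haarTorus n) ℂ (trigPoly c) =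
      Finsupp.linearCombination ℂ (fun h : Fin n → ℤ =>
        ContinuousMap.toLp (E := ℂ) 2 (haarTorus n) ℂ (UnitAddTorus.mFourier (-h))) c := by
  rw [trigPoly, Finsupp.linearCombination_apply, Finsupp.linearCombination_apply, map_finsuppSum]
  simp only [map_smul]

lemma eLpNorm_comp_torusProj {n : ℕ} {g : UnitAddTorus (Fin n) → ℂ}
    (hg : AEStronglyMeasurable g (haarTorus n)) :
    eLpNorm (fun ξ => g (torusProj ξ)) 2 (volume.restrict (unitCube n)) =
      eLpNorm g 2 (haarTorus n) :=
  eLpNorm_comp_measurePreserving hg (measurePreserving_torusProj n)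

lemma eLpNorm_trigPoly {n : ℕ} (c : (Fin n → ℤ) →₀ ℂ) :
    eLpNorm (fun ξ => trigPoly c (torusProj ξ)) 2 (volume.restrict (unitCube n)) =
      ‖ContinuousMap.toLp (E := ℂ) 2 (haarTorus n) ℂ (trigPoly c)‖ₑ := by
  rw [Lp.enorm_def, eLpNorm_congr_ae (ContinuousMap.coeFn_toLp (haarTorus n) (trigPoly c))]
  exact eLpNorm_comp_torusProj (trigPoly c).continuous.aestronglyMeasurable

/-- Trigonometric polynomials are dense in `L₂` of the unit cube. -/
lemma exists_trigPoly_approx {n : ℕ} {u : EuclideanSpace ℝ (Fin n) → ℂ}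
    (hu : MemLp u 2 (volume.restrict (unitCube n))) (hm : StronglyMeasurable u)
    {ε : ℝ≥0∞} (hε : ε ≠ 0) :
    ∃ c : (Fin n → ℤ) →₀ ℂ, eLpNorm (fun ξ => u ξ - trigPoly c (torusProj ξ)) 2
      (volume.restrict (unitCube n)) < ε := by
  have hcomp : (fun ξ => u (torusLift (torusProj ξ))) =ᵐ[volume.restrict (unitCube n)] u := by
    filter_upwards [ae_restrict_mem (measurableSet_unitCube n)] with ξ hξ
    rw [torusLift_torusProj hξ]
  have hv : MemLp (fun t => u (torusLift t)) 2 (haarTorus n) := by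
    refine ⟨(hm.comp_measurable measurable_torusLift).aestronglyMeasurable, ?_⟩
    rw [← eLpNorm_comp_torusProj (g := fun t => u (torusLift t))
      (hm.comp_measurable measurable_torusLift).aestronglyMeasurable]
    exact (eLpNorm_congr_ae hcomp).trans_lt hu.2
  have hd : hv.toLp ∈ (Submodule.span ℂ (Set.range fun h : Fin n → ℤ =>
      ContinuousMap.toLp (E := ℂ) 2 (haarTorus n) ℂ
        (UnitAddTorus.mFourier (-h)))).topologicalClosure := by
    have h1 := UnitAddTorus.span_mFourierLp_closure_eq_top (d := Fin n) (p := 2) (by simp)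
    have h2 : Set.range (fun h : Fin n → ℤ => ContinuousMap.toLp (E := ℂ) 2 (haarTorus n) ℂ
        (UnitAddTorus.mFourier (-h))) = Set.range (UnitAddTorus.mFourierLp (d := Fin n) 2) :=
      neg_surjective.range_comp (UnitAddTorus.mFourierLp (d := Fin n) 2)
    rw [h2]
    have h3 : hv.toLp ∈ (⊤ : Submodule ℂ (Lp ℂ 2 (haarTorus n))) := trivial
    rw [← h1] at h3
    exact h3
  obtain ⟨p, hp, hlt⟩ := EMetric.mem_closure_iff.1 hd ε (pos_iff_ne_zero.2 hε)
  obtain ⟨c, rfl⟩ := (Finsupp.mem_span_range_iff_exists_finsupp).1 hp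
  refine ⟨c, ?_⟩
  have h4 : (c.sum fun i a => a • (fun h : Fin n → ℤ =>
        ContinuousMap.toLp (E := ℂ) 2 (haarTorus n) ℂ (UnitAddTorus.mFourier (-h))) i) =
      ContinuousMap.toLp (E := ℂ) 2 (haarTorus n) ℂ (trigPoly c) := by
    rw [toLp_trigPoly, Finsupp.linearCombination_apply]
  rw [h4, Lp.edist_def] at hlt
  refine lt_of_eq_of_lt ?_ hlt
  have h5 : (⇑hv.toLp - ⇑(ContinuousMap.toLp (E := ℂ) 2 (haarTorus n) ℂ (trigPoly c)))
      =ᵐ[haarTorus n] fun t => u (torusLift t) - trigPoly c t :=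
    hv.coeFn_toLp.sub (ContinuousMap.coeFn_toLp (haarTorus n) (trigPoly c))
  rw [eLpNorm_congr_ae h5, ← eLpNorm_comp_torusProj (g := fun t => u (torusLift t) - trigPoly c t)
    ((hm.comp_measurable measurable_torusLift).aestronglyMeasurable.sub
      (trigPoly c).continuous.aestronglyMeasurable)]
  refine eLpNorm_congr_ae ?_
  filter_upwards [hcomp] with ξ hξ
  rw [hξ]

lemma eLpNorm_withDensity_le {n : ℕ} {μ : Measure (EuclideanSpace ℝ (Fin n))}
    {S : EuclideanSpace ℝ (Fin n) → ℝ≥0∞} {M : ℝ≥0∞} (hSM : ∀ᵐ ξ ∂μ, S ξ ≤ M)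
    (v : EuclideanSpace ℝ (Fin n) → ℂ) :
    eLpNorm v 2 (μ.withDensity S) ≤ M ^ (2⁻¹ : ℝ) * eLpNorm v 2 μ := by
  have hνμ : μ.withDensity S ≤ M • μ := by
    rw [← withDensity_const]
    exact withDensity_mono hSM
  refine (eLpNorm_mono_measure v hνμ).trans ?_
  rw [eLpNorm_smul_measure_of_ne_top (by simp), smul_eq_mul]
  simp

lemma rpow_inv_two_sq (x : ℝ≥0∞) : (x ^ (2⁻¹ : ℝ)) ^ 2 = x := by
  rw [← ENNReal.rpow_natCast, ← ENNReal.rpow_mul]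
  norm_num

/-- A bounded weight `S` is at most `a²` if the `S`-weighted `L₂` norm of every trigonometric
polynomial is at most `a` times its `L₂` norm: by density the same holds for indicators. -/
lemma ae_le_of_eLpNorm_trigPoly_le {n : ℕ} {S : EuclideanSpace ℝ (Fin n) → ℝ≥0∞}
    (hS : Measurable S) {M a : ℝ≥0∞} (hM : M ≠ ∞) (ha : a ≠ ∞)
    (hSM : ∀ᵐ ξ ∂(volume.restrict (unitCube n)), S ξ ≤ M)
    (h : ∀ c : (Fin n → ℤ) →₀ ℂ,
      eLpNorm (fun ξ => trigPoly c (torusProj ξ)) 2 ((volume.restrict (unitCube n)).withDensity S) ≤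
        a * eLpNorm (fun ξ => trigPoly c (torusProj ξ)) 2 (volume.restrict (unitCube n))) :
    ∀ᵐ ξ ∂(volume.restrict (unitCube n)), S ξ ≤ a ^ 2 := by
  set μ := volume.restrict (unitCube n) with hμ
  set ν := μ.withDensity S with hν
  have hb' : M ^ (2⁻¹ : ℝ) ≠ ∞ := ENNReal.rpow_ne_top_of_nonneg (by norm_num) hM
  refine ae_le_of_forall_setLIntegral_le_of_sigmaFinite hS fun A hA _ => ?_
  rw [setLIntegral_const, ← withDensity_apply S hA]
  set u : EuclideanSpace ℝ (Fin n) → ℂ := A.indicator fun _ => 1 with hu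
  have hum : StronglyMeasurable u := stronglyMeasurable_const.indicator hA
  have huL : MemLp u 2 μ := memLp_indicator_const 2 hA 1 (Or.inr (measure_ne_top _ _))
  have key : eLpNorm u 2 ν ≤ a * eLpNorm u 2 μ := by
    -- Approximate the indicator by a trigonometric polynomial; the error is small in both norms
    -- because the weight is bounded.
    have hcore : ∀ ε : ℝ≥0∞, ε ≠ 0 →
        eLpNorm u 2 ν ≤ a * eLpNorm u 2 μ + (a + M ^ (2⁻¹ : ℝ)) * ε := by
      intro ε hε
      obtain ⟨c, hc⟩ := exists_trigPoly_approx huL hum hε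
      set p : EuclideanSpace ℝ (Fin n) → ℂ := fun ξ => trigPoly c (torusProj ξ) with hp
      have hpm : ∀ m : Measure (EuclideanSpace ℝ (Fin n)), AEStronglyMeasurable p m := fun m =>
        ((trigPoly c).continuous.comp continuous_torusProj).aestronglyMeasurable
      have hup : ∀ m : Measure (EuclideanSpace ℝ (Fin n)),
          AEStronglyMeasurable (fun ξ => u ξ - p ξ) m := fun m =>
        hum.aestronglyMeasurable.sub (hpm m)
      have h1 : eLpNorm u 2 ν ≤ eLpNorm (fun ξ => u ξ - p ξ) 2 ν + eLpNorm p 2 ν := by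
        refine le_trans (le_of_eq ?_) (eLpNorm_add_le (hup ν) (hpm ν) (by norm_num))
        congr 1; ext ξ; simp
      have h2 : eLpNorm p 2 μ ≤ eLpNorm u 2 μ + eLpNorm (fun ξ => u ξ - p ξ) 2 μ := by
        refine le_trans (le_of_eq ?_)
          (eLpNorm_sub_le hum.aestronglyMeasurable (hup μ) (by norm_num))
        congr 1; ext ξ; simp
      calc eLpNorm u 2 ν ≤ M ^ (2⁻¹ : ℝ) * ε + a * (eLpNorm u 2 μ + ε) := by
            refine h1.trans (add_le_add ((eLpNorm_withDensity_le hSM _).trans ?_) ((h c).trans ?_))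
            · gcongr
            · gcongr
              exact h2.trans (by gcongr)
        _ = _ := by ring
    have hlim : Tendsto (fun ε : ℝ≥0∞ => a * eLpNorm u 2 μ + (a + M ^ (2⁻¹ : ℝ)) * ε) (𝓝[≠] 0)
        (𝓝 (a * eLpNorm u 2 μ + (a + M ^ (2⁻¹ : ℝ)) * 0)) := by
      refine tendsto_nhdsWithin_of_tendsto_nhds ?_
      refine tendsto_const_nhds.add (ENNReal.Tendsto.const_mul tendsto_id (Or.inr ?_))
      exact ENNReal.add_ne_top.2 ⟨ha, hb'⟩
    rw [mul_zero, add_zero] at hlim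
    refine ge_of_tendsto hlim ?_
    filter_upwards [self_mem_nhdsWithin] with ε hε using hcore ε hε
  rw [hu, eLpNorm_indicator_const hA (by simp) (by simp),
    eLpNorm_indicator_const hA (by simp) (by simp)] at key
  have := pow_le_pow_left₀ zero_le key 2
  simpa [mul_pow, rpow_inv_two_sq] using this

/-! ### Periodization -/

/-- Integration over `ℝⁿ` is integration of the periodization over the unit cube. -/
lemma lintegral_eq_lintegral_unitCube_tsum {n : ℕ} {F : EuclideanSpace ℝ (Fin n) → ℝ≥0∞}
    (hF : Measurable F) :
    ∫⁻ ξ, F ξ = ∫⁻ ξ in unitCube n, ∑' ℓ : Fin n → ℤ, F (ξ + intPoint ℓ) := by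
  -- `ℝⁿ` is the disjoint union of the integer translates of the cube.
  have hcover : (⋃ ℓ : Fin n → ℤ, (fun ξ => ξ - intPoint ℓ) ⁻¹' unitCube n) = Set.univ := by
    refine Set.eq_univ_of_forall fun ξ => Set.mem_iUnion.2 ⟨fun s => ⌈ξ s⌉ - 1, fun s => ?_⟩
    have h1 := Int.ceil_lt_add_one (ξ s)
    have h2 := Int.le_ceil (ξ s)
    simp only [intPoint, PiLp.sub_apply, Set.mem_Ioc]
    push_cast
    constructor <;> linarith
  have hdisj : Pairwise (Function.onFun Disjoint
      fun ℓ : Fin n → ℤ => (fun ξ => ξ - intPoint ℓ) ⁻¹' unitCube n) := by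
    intro ℓ ℓ' hne
    rw [Function.onFun, Set.disjoint_left]
    intro ξ h h'
    refine hne (funext fun s => ?_)
    have h1 := h s
    have h2 := h' s
    simp only [intPoint, PiLp.sub_apply, Set.mem_Ioc] at h1 h2
    have h3 : (ℓ s : ℝ) < ℓ' s + 1 := by linarith
    have h4 : (ℓ' s : ℝ) < ℓ s + 1 := by linarith
    have h5 : ℓ s < ℓ' s + 1 := by exact_mod_cast h3
    have h6 : ℓ' s < ℓ s + 1 := by exact_mod_cast h4
    omega
  have hFadd : ∀ ℓ : Fin n → ℤ, Measurable fun ξ => F (ξ + intPoint ℓ) := fun ℓ =>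
    hF.comp (measurable_add_const _)
  rw [lintegral_tsum fun ℓ => (hFadd ℓ).aemeasurable,
    ← setLIntegral_univ, ← hcover, lintegral_iUnion
      (fun ℓ => (measurableSet_unitCube n).preimage (measurable_sub_const _)) hdisj]
  refine tsum_congr fun ℓ => ?_
  have h := (measurePreserving_sub_right volume (intPoint ℓ)).setLIntegral_comp_preimage
    (measurableSet_unitCube n) (hFadd ℓ)
  simpa using h

/-- The symbol in the frequency variable `ξ = ω / 2π` of Mathlib's Fourier transform. -/
noncomputable def weight {n : ℕ} (k : Fin n → ℤ) (φ : L2 n) (ξ : EuclideanSpace ℝ (Fin n)) :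
    ℝ≥0∞ :=
  ∑' ℓ : Fin n → ℤ, ‖multiplier k (ξ + intPoint ℓ) * (𝓕 φ : L2 n) (ξ + intPoint ℓ)‖ₑ ^ 2

lemma measurable_multiplier_mul {n : ℕ} (k : Fin n → ℤ) (F : L2 n) :
    Measurable fun ξ => multiplier k ξ * F ξ :=
  (measurable_multiplier k).mul (Lp.stronglyMeasurable F).measurable

lemma measurable_weight {n : ℕ} (k : Fin n → ℤ) (φ : L2 n) : Measurable (weight k φ) := by
  refine Measurable.tsum fun ℓ => ?_
  exact (((measurable_multiplier_mul k (𝓕 φ)).comp (measurable_add_const _)).enorm).pow_const 2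

lemma symbol_two_pi_smul {n : ℕ} (k : Fin n → ℤ) (φ : L2 n) (ξ : EuclideanSpace ℝ (Fin n)) :
    symbol k φ ((2 * Real.pi) • ξ) = weight k φ ξ := by
  refine tsum_congr fun ℓ => ?_
  have hpi : (2 * Real.pi) ≠ 0 := by positivity
  rw [hat, ← smul_add, smul_smul, inv_mul_cancel₀ hpi, one_smul, ← ofReal_norm,
    ← ENNReal.ofReal_pow (norm_nonneg _), norm_mul, mul_pow]
  congr 2
  rw [multiplier, norm_prod, ← Finset.prod_pow]
  refine Finset.prod_congr rfl fun s _ => ?_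
  rw [norm_zpow, ← zpow_natCast, ← zpow_mul, mul_comm (k s)]
  congr 1
  simp [intPoint, abs_mul, ← mul_add, -Complex.ofReal_add]

lemma weight_add_intPoint {n : ℕ} (k : Fin n → ℤ) (φ : L2 n) (ξ : EuclideanSpace ℝ (Fin n))
    (h : Fin n → ℤ) : weight k φ (ξ + intPoint h) = weight k φ ξ := by
  have hadd : ∀ ℓ : Fin n → ℤ, ξ + intPoint h + intPoint ℓ = ξ + intPoint (h + ℓ) := by
    intro ℓ
    rw [add_assoc]
    congr 1
    ext s
    simp [intPoint]
  simp only [weight, hadd]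
  exact (Equiv.addLeft h).tsum_eq
    fun ℓ => ‖multiplier k (ξ + intPoint ℓ) * (𝓕 φ : L2 n) (ξ + intPoint ℓ)‖ₑ ^ 2

lemma ae_weight_le_supSymbol {n : ℕ} (k : Fin n → ℤ) (φ : L2 n) :
    ∀ᵐ ξ, weight k φ ξ ≤ supSymbol k φ := by
  have h : ∀ᵐ ω, symbol k φ ω ≤ supSymbol k φ := ENNReal.ae_le_essSup _
  have hq : Measure.QuasiMeasurePreserving
      (fun ξ : EuclideanSpace ℝ (Fin n) => (2 * Real.pi) • ξ) volume volume := by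
    refine ⟨measurable_const_smul _, ?_⟩
    rw [Measure.map_addHaar_smul _ (by positivity)]
    exact Measure.smul_absolutelyContinuous
  filter_upwards [hq.ae h] with ξ hξ
  rwa [← symbol_two_pi_smul]

/-- A bound for the periodic weight on the unit cube is a bound for the essential supremum. -/
lemma supSymbol_le {n : ℕ} {k : Fin n → ℤ} {φ : L2 n} {b : ℝ≥0∞}
    (h : ∀ᵐ ξ ∂(volume.restrict (unitCube n)), weight k φ ξ ≤ b) : supSymbol k φ ≤ b := by
  -- By periodicity, the set where the bound fails on `ℝⁿ` folds into a null subset of the cube.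
  have h1 : ∀ᵐ ξ, weight k φ ξ ≤ b := by
    have hB : MeasurableSet {ξ | b < weight k φ ξ} :=
      measurableSet_lt measurable_const (measurable_weight k φ)
    have h2 := lintegral_eq_lintegral_unitCube_tsum
      (measurable_one.indicator hB : Measurable ({ξ | b < weight k φ ξ}.indicator
        (1 : EuclideanSpace ℝ (Fin n) → ℝ≥0∞)))
    rw [lintegral_indicator_one hB] at h2
    have h3 : ∫⁻ ξ in unitCube n, ∑' ℓ : Fin n → ℤ,
        {ξ | b < weight k φ ξ}.indicator (1 : EuclideanSpace ℝ (Fin n) → ℝ≥0∞)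
          (ξ + intPoint ℓ) = 0 := by
      refine (lintegral_congr_ae ?_).trans lintegral_zero
      filter_upwards [h] with ξ hξ
      simp [weight_add_intPoint, not_lt.2 hξ]
    rw [ae_iff]
    simpa using h2.trans h3
  refine essSup_le_of_ae_le _ ?_
  have hq : Measure.QuasiMeasurePreserving
      (fun ξ : EuclideanSpace ℝ (Fin n) => (2 * Real.pi)⁻¹ • ξ) volume volume := by
    refine ⟨measurable_const_smul _, ?_⟩
    rw [Measure.map_addHaar_smul _ (by positivity)]
    exact Measure.smul_absolutelyContinuous
  filter_upwards [hq.ae h1] with ω hω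
  rwa [← symbol_two_pi_smul, smul_smul, mul_inv_cancel₀ (by positivity), one_smul] at hω

/-! ### Finite combinations of shifts -/

/-- The finite combination `∑ c_h φ(· - h)`. -/
noncomputable def shiftSum {n : ℕ} (φ : L2 n) (c : (Fin n → ℤ) →₀ ℂ) : L2 n :=
  Finsupp.linearCombination ℂ (fun h => shift h φ) c

lemma shiftSum_mem_W {n : ℕ} (φ : L2 n) (c : (Fin n → ℤ) →₀ ℂ) : shiftSum φ c ∈ W φ :=
  Submodule.le_topologicalClosure _
    ((Finsupp.mem_span_range_iff_exists_finsupp).2 ⟨c, rfl⟩)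

lemma fourier_shiftSum {n : ℕ} (φ : L2 n) (c : (Fin n → ℤ) →₀ ℂ) :
    (𝓕 (shiftSum φ c) : L2 n) =ᵐ[volume]
      fun ξ => trigPoly c (torusProj ξ) * (𝓕 φ : L2 n) ξ := by
  induction c using Finsupp.induction_linear with
  | zero =>
    have : (𝓕 (shiftSum φ 0) : L2 n) = 0 := by
      simp [shiftSum]
    rw [this]
    filter_upwards with ξ
    simp [trigPoly]
  | add c d hc hd =>
    have : (𝓕 (shiftSum φ (c + d)) : L2 n) = 𝓕 (shiftSum φ c) + 𝓕 (shiftSum φ d) := by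
      rw [shiftSum, map_add, FourierTransform.fourier_add]
      rfl
    rw [this]
    filter_upwards [hc, hd, Lp.coeFn_add (𝓕 (shiftSum φ c)) (𝓕 (shiftSum φ d))] with ξ h1 h2 h3
    rw [h3, Pi.add_apply, h1, h2, ← add_mul, trigPoly, trigPoly, trigPoly, map_add]
    rfl
  | single h a =>
    have : (𝓕 (shiftSum φ (Finsupp.single h a)) : L2 n) = a • 𝓕 (shift h φ) := by
      rw [shiftSum, Finsupp.linearCombination_single, FourierTransform.fourier_smul]
    rw [this]
    filter_upwards [fourier_shift h φ, Lp.coeFn_smul a (𝓕 (shift h φ))] with ξ h1 h2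
    rw [h2, Pi.smul_apply, h1, trigPoly, Finsupp.linearCombination_single]
    simp [mul_assoc]

/-- Both norms are the `ℓ²` norm of `c`, as the shifts and the characters are orthonormal. -/
lemma enorm_shiftSum {n : ℕ} {φ : L2 n} (hφ : Orthonormal ℂ fun h : Fin n → ℤ => shift h φ)
    (c : (Fin n → ℤ) →₀ ℂ) :
    ‖shiftSum φ c‖ₑ =
      eLpNorm (fun ξ => trigPoly c (torusProj ξ)) 2 (volume.restrict (unitCube n)) := by
  rw [eLpNorm_trigPoly, toLp_trigPoly, ← ofReal_norm, ← ofReal_norm, shiftSum,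
    norm_linearCombination_eq_of_orthonormal hφ (orthonormal_mFourierLp_neg n)]

/-- As `p` is periodic, folding the integral over `ℝⁿ` into the unit cube turns the norm of `∂^k f`
into a weighted norm of `p`. -/
lemma eLpNorm_multiplier_mul_fourier_shiftSum {n : ℕ} (k : Fin n → ℤ) (φ : L2 n)
    (c : (Fin n → ℤ) →₀ ℂ) :
    eLpNorm (fun ξ => multiplier k ξ * (𝓕 (shiftSum φ c) : L2 n) ξ) 2 volume =
      eLpNorm (fun ξ => trigPoly c (torusProj ξ)) 2
        ((volume.restrict (unitCube n)).withDensity (weight k φ)) := by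
  have hp : Measurable fun ξ : EuclideanSpace ℝ (Fin n) => trigPoly c (torusProj ξ) :=
    ((trigPoly c).continuous.comp continuous_torusProj).measurable
  have h1 : (fun ξ => multiplier k ξ * (𝓕 (shiftSum φ c) : L2 n) ξ) =ᵐ[volume]
      fun ξ => trigPoly c (torusProj ξ) * (multiplier k ξ * (𝓕 φ : L2 n) ξ) := by
    filter_upwards [fourier_shiftSum φ c] with ξ hξ
    rw [hξ, mul_left_comm]
  have hmeas : Measurable fun ξ =>
      ‖trigPoly c (torusProj ξ) * (multiplier k ξ * (𝓕 φ : L2 n) ξ)‖ₑ ^ 2 :=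
    (hp.mul (measurable_multiplier_mul k (𝓕 φ))).enorm.pow_const 2
  rw [eLpNorm_congr_ae h1, eLpNorm_eq_lintegral_rpow_enorm_toReal (by simp) (by simp),
    eLpNorm_eq_lintegral_rpow_enorm_toReal (by simp) (by simp)]
  congr 1
  simp only [ENNReal.toReal_ofNat, ENNReal.rpow_ofNat]
  rw [lintegral_withDensity_eq_lintegral_mul _ (measurable_weight k φ) (hp.enorm.pow_const 2),
    lintegral_eq_lintegral_unitCube_tsum hmeas]
  refine lintegral_congr fun ξ => ?_
  simp only [torusProj_add_intPoint, enorm_mul, mul_pow, Pi.mul_apply, weight]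
  rw [ENNReal.tsum_mul_left, mul_comm]

/-! ### The Bernstein inequality and its sharpness -/

/-- The bound for finite combinations passes to their closed span `W φ` by Fatou's lemma. -/
lemma eLpNorm_multiplier_mul_fourier_le {n : ℕ} {φ : L2 n}
    (hφ : Orthonormal ℂ fun h : Fin n → ℤ => shift h φ) {k : Fin n → ℤ}
    (hk : supSymbol k φ < ∞) {f : L2 n} (hf : f ∈ W φ) :
    eLpNorm (fun ξ => multiplier k ξ * (𝓕 f : L2 n) ξ) 2 volume ≤
      supSymbol k φ ^ (2⁻¹ : ℝ) * ‖f‖ₑ := by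
  obtain ⟨u, hu, hlim⟩ := mem_closure_iff_seq_limit.1 hf
  have hub : ∀ j, eLpNorm (fun ξ => multiplier k ξ * (𝓕 (u j) : L2 n) ξ) 2 volume ≤
      supSymbol k φ ^ (2⁻¹ : ℝ) * ‖u j‖ₑ := by
    intro j
    obtain ⟨c, hc⟩ := (Finsupp.mem_span_range_iff_exists_finsupp).1 (hu j)
    have hc' : u j = shiftSum φ c := hc.symm
    rw [hc', eLpNorm_multiplier_mul_fourier_shiftSum, enorm_shiftSum hφ]
    exact eLpNorm_withDensity_le (ae_restrict_of_ae (ae_weight_le_supSymbol k φ)) _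
  have hF : Tendsto (fun j => (𝓕 (u j) : L2 n)) atTop (𝓝 (𝓕 f)) :=
    ((FourierTransform.fourierCLM ℂ (L2 n)).continuous.tendsto f).comp hlim
  obtain ⟨r, hr, hae⟩ := (tendstoInMeasure_of_tendsto_Lp hF).exists_seq_tendsto_ae
  refine (Lp.eLpNorm_lim_le_liminf_eLpNorm
    (f := fun i ξ => multiplier k ξ * (𝓕 (u (r i)) : L2 n) ξ)
    (fun i => (measurable_multiplier_mul k _).aestronglyMeasurable) _ ?_).trans ?_
  · filter_upwards [hae] with ξ hξ
    exact hξ.const_mul _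
  · have hlim' : Tendsto (fun i => supSymbol k φ ^ (2⁻¹ : ℝ) * ‖u (r i)‖ₑ) atTop
        (𝓝 (supSymbol k φ ^ (2⁻¹ : ℝ) * ‖f‖ₑ)) := by
      refine ENNReal.Tendsto.const_mul ?_
        (Or.inr (ENNReal.rpow_ne_top_of_nonneg (by norm_num) hk.ne))
      exact (hlim.comp hr.tendsto_atTop).enorm
    -- The bounds for the approximants converge to the claimed bound.
    rw [← hlim'.liminf_eq]
    exact liminf_le_liminf (Eventually.of_forall fun i => hub (r i))

lemma exists_isMixedDeriv_of_mem_W {n : ℕ} {φ : L2 n}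
    (hφ : Orthonormal ℂ fun h : Fin n → ℤ => shift h φ) {k : Fin n → ℤ}
    (hk : supSymbol k φ < ∞) {f : L2 n} (hf : f ∈ W φ) : ∃ g, IsMixedDeriv k f g := by
  refine exists_isMixedDeriv ⟨(measurable_multiplier_mul k _).aestronglyMeasurable, ?_⟩
  refine (eLpNorm_multiplier_mul_fourier_le hφ hk hf).trans_lt ?_
  exact ENNReal.mul_lt_top (ENNReal.rpow_lt_top_of_nonneg (by norm_num) hk.ne) enorm_lt_top

lemma norm_sq_le_of_isMixedDeriv {n : ℕ} {φ : L2 n}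
    (hφ : Orthonormal ℂ fun h : Fin n → ℤ => shift h φ) {k : Fin n → ℤ}
    (hk : supSymbol k φ < ∞) {f g : L2 n} (hf : f ∈ W φ) (hg : IsMixedDeriv k f g) :
    ‖g‖ ^ 2 ≤ (supSymbol k φ).toReal * ‖f‖ ^ 2 := by
  have h := eLpNorm_multiplier_mul_fourier_le hφ hk hf
  rw [← hg.enorm_eq] at h
  have h2 := pow_le_pow_left₀ zero_le h 2
  rw [mul_pow, rpow_inv_two_sq] at h2
  have h3 := ENNReal.toReal_mono (ENNReal.mul_ne_top hk.ne (by simp)) h2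
  simpa using h3

/-- No constant below `M_k` works: otherwise the weight would be bounded by that constant. -/
lemma exists_lt_norm_sq_div {n : ℕ} {φ : L2 n}
    (hφ : Orthonormal ℂ fun h : Fin n → ℤ => shift h φ) {k : Fin n → ℤ}
    (hk : supSymbol k φ < ∞) {b : ℝ} (hb : b < (supSymbol k φ).toReal) :
    ∃ f g : L2 n, f ∈ W φ ∧ f ≠ 0 ∧ IsMixedDeriv k f g ∧ b < ‖g‖ ^ 2 / ‖f‖ ^ 2 := by
  by_contra! hcon
  have hle : ∀ f g : L2 n, f ∈ W φ → IsMixedDeriv k f g → ‖g‖ ^ 2 ≤ b * ‖f‖ ^ 2 := by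
    intro f g hf hg
    rcases eq_or_ne f 0 with rfl | hne
    · simpa using norm_sq_le_of_isMixedDeriv hφ hk hf hg
    · have := hcon f g hf hne hg
      rwa [div_le_iff₀ (by positivity)] at this
  -- The shift `φ(· - 0)` is a nonzero element of `W φ`, so `b` cannot be negative.
  have hb0 : 0 ≤ b := by
    have h1 : shift 0 φ ∈ W φ :=
      Submodule.le_topologicalClosure _ (Submodule.subset_span ⟨0, rfl⟩)
    obtain ⟨g, hg⟩ := exists_isMixedDeriv_of_mem_W hφ hk h1
    have h2 := hle _ _ h1 hg
    rw [hφ.1 0] at h2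
    nlinarith [sq_nonneg ‖g‖]
  have hweight := ae_le_of_eLpNorm_trigPoly_le (measurable_weight k φ) hk.ne
    (ENNReal.ofReal_ne_top (r := √b)) (ae_restrict_of_ae (ae_weight_le_supSymbol k φ)) (by
      intro c
      obtain ⟨g, hg⟩ := exists_isMixedDeriv_of_mem_W hφ hk (shiftSum_mem_W φ c)
      rw [← eLpNorm_multiplier_mul_fourier_shiftSum, ← hg.enorm_eq, ← enorm_shiftSum hφ,
        ← ofReal_norm, ← ofReal_norm, ← ENNReal.ofReal_mul (Real.sqrt_nonneg b)]
      refine ENNReal.ofReal_le_ofReal (abs_le_of_sq_le_sq' ?_ (by positivity)).2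
      rw [mul_pow, Real.sq_sqrt hb0]
      exact hle _ _ (shiftSum_mem_W φ c) hg)
  have h1 := supSymbol_le hweight
  rw [← ENNReal.ofReal_pow (Real.sqrt_nonneg b), Real.sq_sqrt hb0] at h1
  exact absurd (ENNReal.toReal_le_of_le_ofReal hb0 h1) (not_le.2 hb)

end ShiftInvariant

theorem mainTheorem3 (n : ℕ) (φ : ShiftInvariant.L2 n)
    (hφ : Orthonormal ℂ fun h : Fin n → ℤ => ShiftInvariant.shift h φ)
    (k : Fin n → ℤ) (hk : ShiftInvariant.supSymbol k φ < ∞) :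
    (∀ f ∈ ShiftInvariant.W φ,
      (∃! g : ShiftInvariant.L2 n, ShiftInvariant.IsMixedDeriv k f g) ∧
      ∀ g : ShiftInvariant.L2 n, ShiftInvariant.IsMixedDeriv k f g →
        ‖g‖ ^ 2 ≤ (ShiftInvariant.supSymbol k φ).toReal * ‖f‖ ^ 2) ∧
    ∃ f g : ℕ → ShiftInvariant.L2 n,
      (∀ m, f m ∈ ShiftInvariant.W φ ∧ f m ≠ 0 ∧ ShiftInvariant.IsMixedDeriv k (f m) (g m)) ∧
      Tendsto (fun m => ‖g m‖ ^ 2 / ‖f m‖ ^ 2) atTop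
        (𝓝 (ShiftInvariant.supSymbol k φ).toReal) := by
  refine ⟨fun f hf => ⟨?_, fun g hg =>
    ShiftInvariant.norm_sq_le_of_isMixedDeriv hφ hk hf hg⟩, ?_⟩
  · obtain ⟨g, hg⟩ := ShiftInvariant.exists_isMixedDeriv_of_mem_W hφ hk hf
    exact ⟨g, hg, fun g' hg' => hg'.unique hg⟩
  · choose f g hf hne hg hlt using fun m : ℕ => ShiftInvariant.exists_lt_norm_sq_div hφ hk
      (sub_lt_self (ShiftInvariant.supSymbol k φ).toReal (Nat.one_div_pos_of_nat (n := m)))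
    refine ⟨f, g, fun m => ⟨hf m, hne m, hg m⟩, ?_⟩
    refine tendsto_of_tendsto_of_tendsto_of_le_of_le
      (by simpa using tendsto_const_nhds.sub (tendsto_one_div_add_atTop_nhds_zero_nat (𝕜 := ℝ)))
      tendsto_const_nhds (fun m => (hlt m).le) fun m => ?_
    have hpos : 0 < ‖f m‖ := norm_pos_iff.2 (hne m)
    exact (div_le_iff₀ (by positivity)).2
      (ShiftInvariant.norm_sq_le_of_isMixedDeriv hφ hk (hf m) (hg m))
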